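/- A Bratteli diagram $B$ consists of finite vertex sets $V_n$ ($n\ge 0$), $V_0=\{v_0\}$, and finite edge sets $E_n$ ($n\ge 1$) with surjective source and range maps $s:E_n\to V_{n-1}$ and $r:E_n\to V_n$. Its path space $X_B$ is the set of infinite paths $x=(x_i)_{i\ge1}$, $x_i\in E_i$, $r(x_i)=s(x_{i+1})$, with the topology generated by the cylinder sets of finite paths. Let $\mathcal E$ be the tail equivalence relation on $X_B$: $x\mathrel{\mathcal E}y$ if $x_i=y_i$ for all sufficiently large $i$. A Borel measure $\mu$ on $X_B$ is invariant if $\mu(f(A))=\mu(A)$ for every Borel set $A$ and every Borel injection $f:A\to X_B$ with $f(x)\mathrel{\mathcal E}x$ for all $x\in A$; it is ergodic if every $\mathcal E$-invariant Borel set is $\mu$-null or has $\mu$-null complement. A subset of $X_B$ is thin if it has measure zero for every ergodic invariant Borel probability measure on $X_B$. A subdiagram $\overline B=(\overline V,\overline E)$ of $B$ is given by $\overline V\subset V$, $\overline E\subset E$ with $\overline V=s(\overline E)$ and $s(\overline E)=r(\overline E)\cup\{v_0\}$; it is itself a Bratteli diagram, and $X_{\overline B}\subset X_B$. Let $\widehat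 X_{\overline B}\subset X_B$ be the set of paths that are tail equivalent to a path of $X_{\overline B}$. If $\overline\mu$ is an invariant Borel probability measure on $X_{\overline B}$, its extension $\widehat{\overline\mu}$ is the Borel measure on $X_B$ obtained as follows. For $n\ge0$, a vertex $w\in\overline V\cap V_n$, a finite path $e$ in $\overline B$ from $v_0$ to $w$ and a finite path $f$ in $B$ from $v_0$ to $w$, copy $\overline\mu$ from the cylinder set $[e]\subset X_{\overline B}$ to the set of paths that begin with $f$ and continue in $\overline B$, by replacing the initial segment $e$ by $f$; the copy does not depend on $e$. Let $\widehat{\overline\mu}_n$ be the sum of these copies over all $w\in\overline V\cap V_n$ and all $f$. These measures increase with $n$, and $\widehat{\overline\mu}=\sup_n\widehat{\overline\mu}_n$. Statement. Let $\overline B$ be a subdiagram of a Bratteli diagram $B$ such that $X_{\overline B}$ is a thin subset of $X_B$. Then for every invariant Borel probability measure $\overline\mu$ on $X_{\overline B}$ we have $\widehat{\overline\mu}(\widehat X_{\overline B})=\infty$. -/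

import Mathlib

open MeasureTheory
open scoped ENNReal

universe u v

/-- A Bratteli diagram. `V n` is the set of vertices of level `n`, and `E n` is the set of edges
between the levels `n` and `n + 1`, with source map `s` and range map `r`. -/
structure BratteliDiagram where
  V : ℕ → Type u
  E : ℕ → Type v
  s : ∀ n, E n → V n
  r : ∀ n, E n → V (n + 1)
  root : V 0
  eq_root : ∀ w : V 0, w = root
  finite_V : ∀ n, Finite (V n)
  finite_E : ∀ n, Finite (E n)
  s_surjective : ∀ n, Function.Surjective (s n)
  r_surjective : ∀ n, Function.Surjective (r n)

namespace BratteliDiagram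

/-- The infinite paths of a Bratteli diagram, starting at the top vertex. -/
@[ext]
structure Path (B : BratteliDiagram.{u, v}) where
  edge : ∀ i, B.E i
  compat : ∀ i, B.r i (edge i) = B.s (i + 1) (edge (i + 1))

/-- The vertex of level `n` that a path goes through. -/
def Path.vertex {B : BratteliDiagram.{u, v}} (x : B.Path) (n : ℕ) : B.V n := B.s n (x.edge n)

/-- The topology of the path space: the subspace topology of the product of the discrete sets
`E i`. The cylinder sets of finite paths form a basis of it. -/
instance (B : BratteliDiagram.{u, v}) : TopologicalSpace B.Path :=
  TopologicalSpace.induced Path.edge (@Pi.topologicalSpace ℕ B.E fun _ => ⊥)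

/-- The path space carries its Borel σ-algebra. -/
instance (B : BratteliDiagram.{u, v}) : MeasurableSpace B.Path := borel B.Path

instance (B : BratteliDiagram.{u, v}) : BorelSpace B.Path := ⟨rfl⟩

/-- Tail equivalence of infinite paths. -/
def TailEquiv {B : BratteliDiagram.{u, v}} (x y : B.Path) : Prop :=
  ∃ n, ∀ i, n ≤ i → x.edge i = y.edge i

/-- A Borel measure on the path space is invariant under the tail equivalence relation if every
Borel partial injection whose graph is contained in that relation preserves it. -/
def IsInvariant {B : BratteliDiagram.{u, v}} (μ : Measure B.Path) : Prop :=
  ∀ (A : Set B.Path) (f : B.Path → B.Path), MeasurableSet A → Measurable f → Set.InjOn f A →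
    (∀ x ∈ A, TailEquiv x (f x)) → μ (f '' A) = μ A

/-- A Borel measure on the path space is ergodic if every Borel set that is a union of tail
equivalence classes is null or conull. -/
def IsErgodic {B : BratteliDiagram.{u, v}} (μ : Measure B.Path) : Prop :=
  ∀ A : Set B.Path, MeasurableSet A → (∀ x y, TailEquiv x y → x ∈ A → y ∈ A) →
    μ A = 0 ∨ μ Aᶜ = 0

/-- A set of paths is thin if it is a null set of every ergodic invariant probability measure. -/
def IsThin {B : BratteliDiagram.{u, v}} (Z : Set B.Path) : Prop :=
  ∀ μ : Measure B.Path, IsProbabilityMeasure μ → IsInvariant μ → IsErgodic μ → μ Z = 0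

/-- The finite paths from the top vertex to the vertex `w` of level `n`. -/
structure FinPath (B : BratteliDiagram.{u, v}) (n : ℕ) (w : B.V n) where
  vert : ∀ i, i ≤ n → B.V i
  edge : ∀ i, i < n → B.E i
  s_edge : ∀ i (h : i < n), B.s i (edge i h) = vert i h.le
  r_edge : ∀ i (h : i < n), B.r i (edge i h) = vert (i + 1) h
  vert_last : vert n le_rfl = w

/-- The cylinder set of a finite path. -/
def FinPath.cylinder {B : BratteliDiagram.{u, v}} {n : ℕ} {w : B.V n} (p : B.FinPath n w) :
    Set B.Path :=
  {x | ∀ i (h : i < n), x.edge i = p.edge i h}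

theorem nonempty_path_through (B : BratteliDiagram.{u, v}) (n : ℕ) (w : B.V n) :
    Nonempty (B.FinPath n w) := by
  induction n with
  | zero =>
    refine ⟨⟨fun i h => Nat.le_zero.1 h ▸ w, fun i h => absurd h (Nat.not_lt_zero i),
      fun i h => absurd h (Nat.not_lt_zero i), fun i h => absurd h (Nat.not_lt_zero i), rfl⟩⟩
  | succ n ih =>
    obtain ⟨e, rfl⟩ := B.r_surjective n w
    obtain ⟨p⟩ := ih (B.s n e)
    have key : ∀ i, i ≤ n + 1 → ¬ i ≤ n → n + 1 = i := fun i h h' => by omega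
    have key' : ∀ i, i < n + 1 → ¬ i < n → n = i := fun i h h' => by omega
    refine ⟨⟨fun i h => if h' : i ≤ n then p.vert i h' else (key i h h') ▸ B.r n e,
      fun i h => if h' : i < n then p.edge i h' else (key' i h h') ▸ e, ?_, ?_, ?_⟩⟩
    · intro i h
      by_cases h' : i < n
      · simpa [h', h'.le] using p.s_edge i h'
      · obtain rfl := key' i h h'
        simpa using p.vert_last.symm
    · intro i h
      by_cases h' : i < n
      · simpa [h', Nat.succ_le_of_lt h'] using p.r_edge i h'
      · obtain rfl := key' i h h'
        simp
    · simp

/-- A subdiagram `(V̄, Ē)` of `B`: the sets satisfy `V̄ = s(Ē)` and `s(Ē) = r(Ē) ∪ {v₀}`, which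
is written out level by level. -/
structure Subdiagram (B : BratteliDiagram.{u, v}) where
  V : ∀ n, Set (B.V n)
  E : ∀ n, Set (B.E n)
  root_mem : B.root ∈ V 0
  s_image : ∀ n, B.s n '' E n = V n
  r_image : ∀ n, B.r n '' E n = V (n + 1)

namespace Subdiagram

variable {B : BratteliDiagram.{u, v}}

/-- A subdiagram as a Bratteli diagram in its own right. -/
def toDiagram (S : B.Subdiagram) : BratteliDiagram.{u, v} where
  V n := S.V n
  E n := S.E n
  s n e := ⟨B.s n e.1, S.s_image n ▸ Set.mem_image_of_mem _ e.2⟩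
  r n e := ⟨B.r n e.1, S.r_image n ▸ Set.mem_image_of_mem _ e.2⟩
  root := ⟨B.root, S.root_mem⟩
  eq_root w := Subtype.ext (B.eq_root w.1)
  finite_V n := by have := B.finite_V n; infer_instance
  finite_E n := by have := B.finite_E n; infer_instance
  s_surjective n := by
    rintro ⟨w, hw⟩
    rw [← S.s_image n] at hw
    obtain ⟨e, he, rfl⟩ := hw
    exact ⟨⟨e, he⟩, rfl⟩
  r_surjective n := by
    rintro ⟨w, hw⟩
    rw [← S.r_image n] at hw
    obtain ⟨e, he, rfl⟩ := hw
    exact ⟨⟨e, he⟩, rfl⟩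

/-- A path of the subdiagram, viewed as a path of the whole diagram. -/
def incl (S : B.Subdiagram) (x : S.toDiagram.Path) : B.Path where
  edge i := (x.edge i).1
  compat i := congrArg Subtype.val (x.compat i)

/-- The path space of the subdiagram as a subset of the path space of the diagram. -/
def pathSet (S : B.Subdiagram) : Set B.Path := Set.range S.incl

/-- The saturation of the path space of the subdiagram under the tail equivalence relation of the
whole diagram. -/
def saturation (S : B.Subdiagram) : Set B.Path := {y | ∃ x ∈ S.pathSet, TailEquiv y x}

open Classical in
/-- For a finite path `f` of the whole diagram from the top vertex to a vertex `w` of level `n` of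
the subdiagram, and a path `x` of the subdiagram through `w`, this is the path that follows `f` up
to level `n` and `x` from there on. (Paths `x` that do not go through `w` are left alone; this value
is never used.) -/
noncomputable def replacePrefix (S : B.Subdiagram) {n : ℕ} (w : S.toDiagram.V n)
    (f : B.FinPath n w.1) (x : S.toDiagram.Path) : B.Path :=
  if hx : x.vertex n = w then
    { edge := fun i => if h : i < n then f.edge i h else (x.edge i).1
      compat := by
        intro i
        rcases lt_trichotomy (i + 1) n with h | h | h
        · have h' : i < n := by omega
          simp only [h, h', dif_pos]
          rw [f.r_edge, f.s_edge]
        · subst h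
          have := f.vert_last
          simp only [Nat.lt_succ_self, lt_irrefl, dif_pos, dif_neg, not_false_eq_true]
          rw [f.r_edge, f.vert_last, ← hx]
          rfl
        · have h1 : ¬ i < n := by omega
          have h2 : ¬ i + 1 < n := by omega
          simp only [h1, h2, dif_neg, not_false_eq_true]
          exact congrArg Subtype.val (x.compat i) }
  else S.incl x

theorem measurable_replacePrefix (S : B.Subdiagram) {n : ℕ} (w : S.toDiagram.V n)
    (f : B.FinPath n w.1) : Measurable (S.replacePrefix w f) := by
  classical
  apply Continuous.measurable
  let _ : ∀ i, TopologicalSpace (B.E i) := fun _ => ⊥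
  let _ : ∀ i, TopologicalSpace (S.toDiagram.E i) := fun _ => ⊥
  have _ : ∀ i, DiscreteTopology (B.E i) := fun _ => ⟨rfl⟩
  have _ : ∀ i, DiscreteTopology (S.toDiagram.E i) := fun _ => ⟨rfl⟩
  have hc : ∀ i, Continuous fun x : S.toDiagram.Path => x.edge i := fun i =>
    (continuous_apply i).comp continuous_induced_dom
  refine continuous_induced_rng.2 (continuous_pi fun i => ?_)
  let g : S.toDiagram.E n × S.toDiagram.E i → B.E i := fun q =>
    if S.toDiagram.s n q.1 = w then (if h : i < n then f.edge i h else q.2.1) else q.2.1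
  have hg : Continuous g := continuous_of_discreteTopology
  refine (hg.comp ((hc n).prodMk (hc i))).congr fun x => ?_
  by_cases hx : S.toDiagram.s n (x.edge n) = w
  · have hx' : x.vertex n = w := hx
    simp [g, replacePrefix, hx, hx']
  · have hx' : ¬ x.vertex n = w := hx
    simp [g, replacePrefix, hx, hx', incl]

/-- The part of the extension of `μ` that lives on the paths of the whole diagram whose edges from
level `n` on belong to the subdiagram. For each vertex `w` of level `n` of the subdiagram,
fix a finite path `e` of the subdiagram from the top vertex to `w`; for each finite path `f` of
the whole diagram from the top vertex to `w`, the cylinder set of `e` with the measure `μ` on it is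
copied to the set of the paths that begin with `f` and continue in the subdiagram. For
invariant `μ` the choice of `e` does not matter. -/
noncomputable def levelExtension (S : B.Subdiagram) (μ : Measure S.toDiagram.Path) (n : ℕ) :
    Measure B.Path :=
  Measure.sum fun w : S.toDiagram.V n =>
    Measure.sum fun f : B.FinPath n w.1 =>
      (μ.restrict (Classical.choice (S.toDiagram.nonempty_path_through n w)).cylinder).map
        (S.replacePrefix w f)

/-- The extension of a measure from the path space of a subdiagram, by invariance under the tail
equivalence relation of the whole diagram: the supremum of the (increasing) measures
`levelExtension`. It is a measure on the whole path space which vanishes off the saturation. -/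
noncomputable def extension (S : B.Subdiagram) (μ : Measure S.toDiagram.Path) : Measure B.Path :=
  ⨆ n, S.levelExtension μ n

end Subdiagram

end BratteliDiagram

open Filter Topology

namespace BratteliDiagram

variable {B : BratteliDiagram.{u, v}}

/-! Suppose the extension gives the saturation a finite mass `M`. The level measures are then
finite, of total mass at most `M`, and each gives the path space of the subdiagram mass at least 1
(`measure_univ_le_levelExtension_pathSet`). The `n`-th one is invariant under every exchange of two
initial segments of length at most `n` that end at the same vertex (`map_swap_levelExtension`).
Normalise them and take a weak limit in the compact space of probability measures. The limit is
invariant under all exchanges. It still gives the path space of the subdiagram mass at least `M⁻¹`,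
because that set is a decreasing intersection of clopen sets.

Such a measure need not be ergodic. But the mass of a fixed closed set is an affine upper
semicontinuous function on the compact convex set of exchange-invariant probability measures, so it
attains its maximum at an extreme point, and extreme points are ergodic
(`exists_isErgodic_measure_ge`). Exchange invariance implies invariance under all partial injections
inside tail equivalence (`IsSwapInvariant.isInvariant`), so this contradicts thinness. The argument
needs neither monotonicity of the level measures nor invariance of the extension. -/

instance (B : BratteliDiagram.{u, v}) (i : ℕ) : TopologicalSpace (B.E i) := ⊥

instance (B : BratteliDiagram.{u, v}) (i : ℕ) : DiscreteTopology (B.E i) := ⟨rfl⟩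

instance (B : BratteliDiagram.{u, v}) (i : ℕ) : Finite (B.E i) := B.finite_E i

/-! ### Topology of the path space -/

namespace Path

theorem isInducing_edge : IsInducing (Path.edge : B.Path → ∀ i, B.E i) := ⟨rfl⟩

theorem isEmbedding_edge : IsEmbedding (Path.edge : B.Path → ∀ i, B.E i) :=
  ⟨isInducing_edge, fun _ _ h => Path.ext h⟩

theorem continuous_edge (i : ℕ) : Continuous fun x : B.Path => x.edge i :=
  (continuous_apply i).comp isInducing_edge.continuous

theorem isClosed_range_edge : IsClosed (Set.range (Path.edge : B.Path → ∀ i, B.E i)) := by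
  have : Set.range (Path.edge : B.Path → ∀ i, B.E i) =
      ⋂ i, {p | B.r i (p i) = B.s (i + 1) (p (i + 1))} := by
    ext p
    simp only [Set.mem_range, Set.mem_iInter, Set.mem_ofPred_eq]
    exact ⟨by rintro ⟨x, rfl⟩; exact x.compat, fun h => ⟨⟨p, h⟩, rfl⟩⟩
  rw [this]
  refine isClosed_iInter fun i => ?_
  have hc : Continuous fun p : ∀ i, B.E i => (p i, p (i + 1)) :=
    (continuous_apply i).prodMk (continuous_apply (i + 1))
  exact (isClosed_discrete {q : B.E i × B.E (i + 1) | B.r i q.1 = B.s (i + 1) q.2}).preimage hc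

instance : CompactSpace B.Path :=
  (IsClosedEmbedding.mk isEmbedding_edge isClosed_range_edge).compactSpace

instance : T2Space B.Path := isEmbedding_edge.t2Space

instance : SecondCountableTopology B.Path := isEmbedding_edge.secondCountableTopology

instance : TotallyDisconnectedSpace B.Path :=
  ⟨isEmbedding_edge.isTotallyDisconnected_image.1
    (isTotallyDisconnected_of_totallyDisconnectedSpace _)⟩

theorem isClopen_edge_eq (i : ℕ) (e : B.E i) : IsClopen {x : B.Path | x.edge i = e} :=
  (isClopen_discrete {e}).preimage (continuous_edge i)

theorem isClopen_edge_mem (i : ℕ) (s : Set (B.E i)) : IsClopen {x : B.Path | x.edge i ∈ s} :=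
  (isClopen_discrete s).preimage (continuous_edge i)

theorem vertex_succ (x : B.Path) (n : ℕ) : x.vertex (n + 1) = B.r n (x.edge n) :=
  (x.compat n).symm

theorem vertex_eq_of_agree {x y : B.Path} {n : ℕ} (h : ∀ i, i < n → x.edge i = y.edge i) :
    x.vertex n = y.vertex n := by
  cases n with
  | zero => exact (B.eq_root _).trans (B.eq_root _).symm
  | succ n => rw [vertex_succ, vertex_succ, h n n.lt_succ_self]

/-- The paths that have the same first `n` edges as `y`. -/
def prefixCylinder (n : ℕ) (y : B.Path) : Set B.Path := {x | ∀ i, i < n → x.edge i = y.edge i}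

theorem isClopen_prefixCylinder (n : ℕ) (y : B.Path) : IsClopen (prefixCylinder n y) := by
  have : prefixCylinder n y = ⋂ i ∈ Set.Iio n, {x : B.Path | x.edge i = y.edge i} := by
    ext; simp [prefixCylinder]
  rw [this]
  exact (Set.finite_Iio n).isClopen_biInter fun i _ => isClopen_edge_eq i _

open Classical in
/-- Exchange of the initial segments of length `n` of two paths that meet at level `n`. -/
noncomputable def swap (n : ℕ) (y z : B.Path) (h : y.vertex n = z.vertex n) (x : B.Path) :
    B.Path where
  edge i := if i < n then
      (if x ∈ prefixCylinder n y then z.edge i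
        else if x ∈ prefixCylinder n z then y.edge i else x.edge i)
    else x.edge i
  compat i := by
    rcases lt_trichotomy (i + 1) n with hi | hi | hi
    · have h' : i < n := by omega
      simp only [hi, h', if_true]
      split_ifs
      exacts [z.compat i, y.compat i, x.compat i]
    · subst hi
      simp only [Nat.lt_succ_self, lt_irrefl, if_true, if_false]
      change _ = x.vertex (i + 1)
      split_ifs with h1 h2
      · rw [vertex_eq_of_agree h1, h, vertex_succ]
      · rw [vertex_eq_of_agree h2, ← h, vertex_succ]
      · rw [vertex_succ]
    · have h1 : ¬ i < n := by omega
      have h2 : ¬ i + 1 < n := by omega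
      simp only [h1, h2, if_false]
      exact x.compat i

/-! ### Exchanges of initial segments -/

section swap

variable {n : ℕ} {y z : B.Path} (h : y.vertex n = z.vertex n)

theorem swap_edge_of_le (x : B.Path) {i : ℕ} (hi : n ≤ i) :
    (swap n y z h x).edge i = x.edge i := by
  simp [swap, not_lt.2 hi]

theorem swap_edge_of_mem_left {x : B.Path} (hx : x ∈ prefixCylinder n y) {i : ℕ} (hi : i < n) :
    (swap n y z h x).edge i = z.edge i := by
  simp [swap, hi, hx]

theorem swap_edge_of_mem_right {x : B.Path} (hx : x ∈ prefixCylinder n z) {i : ℕ} (hi : i < n) :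
    (swap n y z h x).edge i = y.edge i := by
  -- The two cylinders are equal or disjoint, so the order of the tests in `swap` does not matter.
  by_cases hy : x ∈ prefixCylinder n y
  · rw [swap_edge_of_mem_left h hy hi, ← hx i hi, hy i hi]
  · simp [swap, hi, hx, hy]

theorem swap_of_notMem {x : B.Path} (hy : x ∉ prefixCylinder n y) (hz : x ∉ prefixCylinder n z) :
    swap n y z h x = x := by
  ext i
  simp [swap, hy, hz]

theorem swap_involutive : Function.Involutive (swap n y z h) := by
  intro x
  by_cases hy : x ∈ prefixCylinder n y
  · ext i
    by_cases hi : i < n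
    · rw [swap_edge_of_mem_right h (fun j hj => swap_edge_of_mem_left h hy hj) hi, hy i hi]
    · rw [swap_edge_of_le h _ (not_lt.1 hi), swap_edge_of_le h _ (not_lt.1 hi)]
  by_cases hz : x ∈ prefixCylinder n z
  · ext i
    by_cases hi : i < n
    · rw [swap_edge_of_mem_left h (fun j hj => swap_edge_of_mem_right h hz hj) hi, hz i hi]
    · rw [swap_edge_of_le h _ (not_lt.1 hi), swap_edge_of_le h _ (not_lt.1 hi)]
  · rw [swap_of_notMem h hy hz, swap_of_notMem h hy hz]

theorem tailEquiv_swap (x : B.Path) : TailEquiv x (swap n y z h x) :=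
  ⟨n, fun _ hi => (swap_edge_of_le h x hi).symm⟩

theorem continuous_swap : Continuous (swap n y z h) := by
  classical
  refine isInducing_edge.continuous_iff.2 (continuous_pi fun i => ?_)
  by_cases hi : i < n
  · simp only [swap, Function.comp_def, hi, if_true]
    refine continuous_const.if ?_ (continuous_const.if ?_ (continuous_edge i))
    · intro a ha
      rw [Set.ofPred_mem_eq, (isClopen_prefixCylinder n y).frontier_eq] at ha
      exact ha.elim
    · intro a ha
      rw [Set.ofPred_mem_eq, (isClopen_prefixCylinder n z).frontier_eq] at ha
      exact ha.elim
  · simpa only [swap, Function.comp_def, hi, if_false] using continuous_edge i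

/-- This lets the exchange act on finite paths of length at least `n`. -/
theorem swap_agree {m : ℕ} (hm : n ≤ m) {x x' : B.Path}
    (hx : ∀ i, i < m → x.edge i = x'.edge i) {i : ℕ} (hi : i < m) :
    (swap n y z h x).edge i = (swap n y z h x').edge i := by
  have key : ∀ w : B.Path, x ∈ prefixCylinder n w ↔ x' ∈ prefixCylinder n w := fun w =>
    forall₂_congr fun j hj => by rw [hx j (hj.trans_le hm)]
  by_cases hy : x ∈ prefixCylinder n y
  · simp [swap, hy, (key y).1 hy, hx i hi]
  · by_cases hz : x ∈ prefixCylinder n z <;> simp [swap, hy, hz, ← key, hx i hi]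

end swap

end Path

open BratteliDiagram.Path

/-! ### Exchange invariance implies invariance -/

theorem TailEquiv.symm {x y : B.Path} : TailEquiv x y → TailEquiv y x :=
  fun ⟨n, hn⟩ => ⟨n, fun i hi => (hn i hi).symm⟩

/-- Invariance under all exchanges of initial segments. -/
def IsSwapInvariant (μ : Measure B.Path) : Prop :=
  ∀ (n : ℕ) (y z : B.Path) (h : y.vertex n = z.vertex n), μ.map (swap n y z h) = μ

theorem measure_image_eq_of_forall_eqOn_involutive {X ι : Type*} [MeasurableSpace X] [Countable ι]
    {μ : Measure X} {A : Set X} {f : X → X} (hf : Set.InjOn f A) {s : ι → Set X}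
    (hs : ∀ i, MeasurableSet (s i)) (hA : A = ⋃ i, s i)
    (h : ∀ i, ∃ T : X → X, Measurable T ∧ Function.Involutive T ∧ μ.map T = μ ∧
      Set.EqOn f T (s i)) : μ (f '' A) = μ A := by
  cases isEmpty_or_nonempty ι with
  | inl hι => simp [hA]
  | inr hι =>
    obtain ⟨g, hg⟩ := exists_surjective_nat ι
    -- The pieces may overlap; additivity needs disjoint ones.
    set t := disjointed (s ∘ g) with ht
    have hA' : A = ⋃ k, t k := by
      rw [hA, ht, iUnion_disjointed]
      exact (hg.iUnion_comp s).symm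
    have htm : ∀ k, MeasurableSet (t k) := MeasurableSet.disjointed fun k => hs (g k)
    have key : ∀ k, MeasurableSet (f '' t k) ∧ μ (f '' t k) = μ (t k) := by
      intro k
      obtain ⟨T, hT, hTi, hTμ, hfT⟩ := h (g k)
      -- For an involution images are preimages, which gives measurability and measure at once.
      have : f '' t k = T ⁻¹' t k := by
        rw [(hfT.mono (disjointed_subset (s ∘ g) k)).image_eq,
          Set.image_eq_preimage_of_inverse hTi.leftInverse hTi.rightInverse]
      rw [this]
      refine ⟨hT (htm k), ?_⟩
      conv_rhs => rw [← hTμ, Measure.map_apply hT (htm k)]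
    have hsub : ∀ k, t k ⊆ A := fun k => hA' ▸ Set.subset_iUnion t k
    have hd : Pairwise (Function.onFun Disjoint fun k => f '' t k) := fun i j hij =>
      (disjoint_disjointed (s ∘ g) hij).image hf (hsub i) (hsub j)
    calc μ (f '' A) = μ (⋃ k, f '' t k) := by rw [← Set.image_iUnion, ← hA']
      _ = ∑' k, μ (f '' t k) := measure_iUnion hd fun k => (key k).1
      _ = ∑' k, μ (t k) := by simp only [(key _).2]
      _ = μ A := by rw [hA', measure_iUnion (disjoint_disjointed _) htm]

/-- There are only countably many pairs of finite initial segments, so a partial injection inside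
tail equivalence is, piece by piece, one of countably many exchanges. -/
theorem IsSwapInvariant.isInvariant {μ : Measure B.Path} (hμ : IsSwapInvariant μ) :
    IsInvariant μ := by
  intro A f hA hf hinj htail
  -- The piece indexed by `(n, a, b)`: `x` starts with `a`, `f x` starts with `b`, and both have the
  -- same edges from index `n` on.
  let s : (Σ n : ℕ, (∀ i : Fin n, B.E i) × (∀ i : Fin n, B.E i)) → Set B.Path := fun q =>
    A ∩ ((⋂ i : Fin q.1, {x | x.edge i = q.2.1 i}) ∩
      ((⋂ i : Fin q.1, {x | (f x).edge i = q.2.2 i}) ∩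
        ⋂ i : {i // q.1 ≤ i}, ⋃ e : B.E i, {x | x.edge i = e} ∩ {x | (f x).edge i = e}))
  have hcl : ∀ i e, MeasurableSet {x : B.Path | x.edge i = e} := fun i e =>
    (isClopen_edge_eq i e).isOpen.measurableSet
  refine measure_image_eq_of_forall_eqOn_involutive hinj (s := s) ?_ ?_ ?_
  · intro q
    exact hA.inter ((MeasurableSet.iInter fun i => hcl _ _).inter
      ((MeasurableSet.iInter fun i => hf (hcl _ _)).inter (MeasurableSet.iInter fun i =>
        MeasurableSet.iUnion fun e => (hcl _ _).inter (hf (hcl _ _)))))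
  · refine Set.Subset.antisymm (fun x hx => ?_) (Set.iUnion_subset fun q => Set.inter_subset_left)
    obtain ⟨n, hn⟩ := htail x hx
    refine Set.mem_iUnion.2 ⟨⟨n, fun i => x.edge i, fun i => (f x).edge i⟩, hx, ?_⟩
    simp only [Set.mem_inter_iff, Set.mem_iInter, Set.mem_iUnion, Set.mem_ofPred_eq]
    exact ⟨fun _ => trivial, fun _ => trivial, fun i => ⟨_, rfl, (hn i i.2).symm⟩⟩
  · rintro ⟨n, a, b⟩
    rcases (s ⟨n, a, b⟩).eq_empty_or_nonempty with h0 | ⟨y, hy⟩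
    · exact ⟨id, measurable_id, fun _ => rfl, Measure.map_id, by simp [h0]⟩
    · have hmem : ∀ x ∈ s ⟨n, a, b⟩, (∀ i (hi : i < n), x.edge i = a ⟨i, hi⟩) ∧
          (∀ i (hi : i < n), (f x).edge i = b ⟨i, hi⟩) ∧
          ∀ i, n ≤ i → (f x).edge i = x.edge i := by
        rintro x ⟨-, h1, h2, h3⟩
        simp only [Set.mem_iInter, Set.mem_iUnion, Set.mem_ofPred_eq, Set.mem_inter_iff] at h1 h2 h3
        refine ⟨fun i hi => h1 ⟨i, hi⟩, fun i hi => h2 ⟨i, hi⟩, fun i hi => ?_⟩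
        obtain ⟨e, h4, h5⟩ := h3 ⟨i, hi⟩
        exact h5.trans h4.symm
      obtain ⟨hy1, hy2, hy3⟩ := hmem y hy
      have hv : y.vertex n = (f y).vertex n := congrArg (B.s n) (hy3 n le_rfl).symm
      refine ⟨swap n y (f y) hv, (continuous_swap hv).measurable, swap_involutive hv,
        hμ n y (f y) hv, fun x hx => ?_⟩
      obtain ⟨hx1, hx2, hx3⟩ := hmem x hx
      ext i
      by_cases hi : i < n
      · rw [swap_edge_of_mem_left hv (fun j hj => (hx1 j hj).trans (hy1 j hj).symm) hi, hx2 i hi,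
          hy2 i hi]
      · rw [swap_edge_of_le hv x (not_lt.1 hi), hx3 i (not_lt.1 hi)]

theorem IsSwapInvariant.restrict {μ : Measure B.Path} (hμ : IsSwapInvariant μ) {A : Set B.Path}
    (hA : MeasurableSet A) (hAt : ∀ x y, TailEquiv x y → x ∈ A → y ∈ A) :
    IsSwapInvariant (μ.restrict A) := by
  intro n y z h
  have : swap n y z h ⁻¹' A = A := by
    ext x
    exact ⟨hAt _ _ (tailEquiv_swap h x).symm, hAt _ _ (tailEquiv_swap h x)⟩
  conv_lhs => rw [← this]
  rw [← Measure.restrict_map (continuous_swap h).measurable hA, hμ]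

theorem IsSwapInvariant.smul {μ : Measure B.Path} (hμ : IsSwapInvariant μ) (c : ℝ≥0∞) :
    IsSwapInvariant (c • μ) := fun n y z h => by
  rw [Measure.map_smul, hμ]

/-! ### Compactness, and passage to an ergodic measure -/

theorem isClosed_isSwapInvariant :
    IsClosed {Q : ProbabilityMeasure B.Path | IsSwapInvariant (Q : Measure B.Path)} := by
  have : {Q : ProbabilityMeasure B.Path | IsSwapInvariant (Q : Measure B.Path)} =
      ⋂ (n : ℕ) (y : B.Path) (z : B.Path) (h : y.vertex n = z.vertex n),
        {Q | Q.map (continuous_swap h).measurable.aemeasurable = Q} := by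
    ext Q
    simp only [IsSwapInvariant, Set.mem_ofPred_eq, Set.mem_iInter]
    refine forall₄_congr fun n y z h => ?_
    rw [← ProbabilityMeasure.toMeasure_injective.eq_iff, ProbabilityMeasure.toMeasure_map]
  rw [this]
  exact isClosed_iInter fun n => isClosed_iInter fun y => isClosed_iInter fun z =>
    isClosed_iInter fun h =>
      isClosed_eq (ProbabilityMeasure.continuous_map (continuous_swap h)) continuous_id

theorem continuous_measure_of_isClopen {X : Type*} [TopologicalSpace X] [MeasurableSpace X]
    [BorelSpace X] [HasOuterApproxClosed X] {C : Set X} (hC : IsClopen C) :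
    Continuous fun Q : ProbabilityMeasure X => (Q : Measure X) C :=
  continuous_iff_continuousAt.2 fun _ =>
    ProbabilityMeasure.tendsto_measure_of_null_frontier_of_tendsto' tendsto_id
      (by simp [hC.frontier_eq])

theorem upperSemicontinuous_measure_iInter {X : Type*} [TopologicalSpace X] [MeasurableSpace X]
    [BorelSpace X] [HasOuterApproxClosed X] {U : ℕ → Set X} (hU : ∀ n, IsClopen (U n))
    (hanti : Antitone U) :
    UpperSemicontinuous fun Q : ProbabilityMeasure X => (Q : Measure X) (⋂ n, U n) := by
  have : (fun Q : ProbabilityMeasure X => (Q : Measure X) (⋂ n, U n)) =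
      fun Q : ProbabilityMeasure X => ⨅ n, (Q : Measure X) (U n) := by
    funext Q
    exact hanti.measure_iInter (fun n => (hU n).isOpen.measurableSet.nullMeasurableSet)
      ⟨0, measure_ne_top _ _⟩
  rw [this]
  exact upperSemicontinuous_iInf fun n => (continuous_measure_of_isClopen (hU n)).upperSemicontinuous

theorem measure_ext_of_isClopen {X : Type*} [TopologicalSpace X] [MeasurableSpace X]
    [BorelSpace X] [CompactSpace X] [T2Space X] [TotallyDisconnectedSpace X]
    [SecondCountableTopology X] {μ ν : Measure X} [IsProbabilityMeasure μ] [IsProbabilityMeasure ν]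
    (h : ∀ C, IsClopen C → μ C = ν C) : μ = ν := by
  refine ext_of_generate_finite {C | IsClopen C} ?_ ?_ h (by simp)
  · rw [BorelSpace.measurable_eq (α := X)]
    exact loc_compact_Haus_tot_disc_of_zero_dim.borel_eq_generateFrom
  · exact fun s hs t ht _ => IsClopen.inter hs ht

theorem le_left_of_convex_combination_eq {a b p q r : ℝ} (ha : 0 < a) (hb : 0 ≤ b) (hab : a + b = 1)
    (h : r = a * p + b * q) (hq : q ≤ r) : r ≤ p := by
  have hbq : b * q ≤ b * r := mul_le_mul_of_nonneg_left hq hb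
  have hr : a * r + b * r = r := by rw [← add_mul, hab, one_mul]
  exact le_of_mul_le_mul_left (by linarith) ha

/-- Maximise the mass of the intersection over the invariant probability measures and take an
extreme point of the set of maximisers. A nontrivial invariant Borel set would split it into two
conditional measures, which are again maximisers. -/
theorem exists_isErgodic_measure_ge (P : ProbabilityMeasure B.Path)
    (hP : IsSwapInvariant (P : Measure B.Path)) {U : ℕ → Set B.Path} (hU : ∀ n, IsClopen (U n))
    (hanti : Antitone U) :
    ∃ Q : ProbabilityMeasure B.Path, IsSwapInvariant (Q : Measure B.Path) ∧
      IsErgodic (Q : Measure B.Path) ∧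
      (P : Measure B.Path) (⋂ n, U n) ≤ (Q : Measure B.Path) (⋂ n, U n) := by
  set Z := ⋂ n, U n with hZ
  have husc := upperSemicontinuous_measure_iInter hU hanti
  set K := {Q : ProbabilityMeasure B.Path | IsSwapInvariant (Q : Measure B.Path)} with hK
  have hKc : IsCompact K := isClosed_isSwapInvariant.isCompact
  obtain ⟨M, hMK, hM⟩ := (husc.upperSemicontinuousOn K).exists_isMaxOn ⟨P, hP⟩ hKc
  set F := {Q ∈ K | (M : Measure B.Path) Z ≤ (Q : Measure B.Path) Z} with hF
  have hFc : IsCompact F := hKc.inter_right (husc.isClosed_preimage _)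
  -- Krein–Milman needs a locally convex space. The values on clopen sets determine the measure, so
  -- they embed the probability measures into a real product space.
  let Φ : ProbabilityMeasure B.Path → {C : Set B.Path // IsClopen C} → ℝ :=
    fun Q C => (Q : Measure B.Path).real C
  have hΦ : Continuous Φ := continuous_pi fun C =>
    ENNReal.continuousOn_toReal.comp_continuous (continuous_measure_of_isClopen C.2)
      fun Q => measure_ne_top _ _
  have hΦinj : Function.Injective Φ := fun Q R h =>
    ProbabilityMeasure.toMeasure_injective <| measure_ext_of_isClopen fun C hC =>
      (ENNReal.toReal_eq_toReal_iff' (measure_ne_top _ _) (measure_ne_top _ _)).1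
        (congrFun h ⟨C, hC⟩)
  obtain ⟨_, ⟨⟨Q, hQF, rfl⟩, hQ⟩⟩ := (hFc.image hΦ).extremePoints_nonempty ⟨_, M, ⟨hMK, le_rfl⟩, rfl⟩
  refine ⟨Q, hQF.1, ?_, (hM hP).trans hQF.2⟩
  intro A hA hAt
  by_contra! hne
  obtain ⟨h1, h2⟩ := hne
  have hAt' : ∀ x y, TailEquiv x y → x ∈ Aᶜ → y ∈ Aᶜ :=
    fun x y hxy hx hy => hx (hAt _ _ hxy.symm hy)
  have hQ1 := ProbabilityTheory.cond_isProbabilityMeasure h1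
  have hQ2 := ProbabilityTheory.cond_isProbabilityMeasure h2
  let Q1 : ProbabilityMeasure B.Path := ⟨ProbabilityTheory.cond Q A, hQ1⟩
  let Q2 : ProbabilityMeasure B.Path := ⟨ProbabilityTheory.cond Q Aᶜ, hQ2⟩
  have hK1 : Q1 ∈ K := (hQF.1.restrict hA hAt).smul _
  have hK2 : Q2 ∈ K := (hQF.1.restrict hA.compl hAt').smul _
  have hsplit : ∀ C, (Q : Measure B.Path).real C =
      (Q : Measure B.Path).real A * (Q1 : Measure B.Path).real C +
        (Q : Measure B.Path).real Aᶜ * (Q2 : Measure B.Path).real C := by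
    intro C
    have e1 : (Q1 : Measure B.Path) C * (Q : Measure B.Path) A = (Q : Measure B.Path) (A ∩ C) :=
      ProbabilityTheory.cond_mul_eq_inter hA C _
    have e2 : (Q2 : Measure B.Path) C * (Q : Measure B.Path) Aᶜ = (Q : Measure B.Path) (Aᶜ ∩ C) :=
      ProbabilityTheory.cond_mul_eq_inter hA.compl C _
    simp only [Measure.real, mul_comm (ENNReal.toReal ((Q : Measure B.Path) _)),
      ← ENNReal.toReal_mul, e1, e2]
    rw [← ENNReal.toReal_add (measure_ne_top _ _) (measure_ne_top _ _), Set.inter_comm A,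
      Set.inter_comm Aᶜ, ← Set.sdiff_eq, measure_inter_add_sdiff _ hA]
  have hpos1 : 0 < (Q : Measure B.Path).real A := ENNReal.toReal_pos h1 (measure_ne_top _ _)
  have hpos2 : 0 < (Q : Measure B.Path).real Aᶜ := ENNReal.toReal_pos h2 (measure_ne_top _ _)
  have hsum : (Q : Measure B.Path).real A + (Q : Measure B.Path).real Aᶜ = 1 :=
    probReal_add_probReal_compl hA
  have hle : ∀ R ∈ K, (R : Measure B.Path).real Z ≤ (Q : Measure B.Path).real Z := fun R hR =>
    ENNReal.toReal_mono (measure_ne_top _ _) ((hM hR).trans hQF.2)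
  have hmem : ∀ R ∈ K, (Q : Measure B.Path).real Z ≤ (R : Measure B.Path).real Z → R ∈ F :=
    fun R hR h => ⟨hR, hQF.2.trans
      ((ENNReal.toReal_le_toReal (measure_ne_top _ _) (measure_ne_top _ _)).1 h)⟩
  -- An average of two values, neither above the maximum, equals the maximum only if both do.
  have hZs := hsplit Z
  have l1 := hle Q1 hK1
  have l2 := hle Q2 hK2
  have hF1 : Q1 ∈ F := hmem Q1 hK1 (le_left_of_convex_combination_eq hpos1 hpos2.le hsum hZs l2)
  have hF2 : Q2 ∈ F := 
    hmem Q2 hK2 (le_left_of_convex_combination_eq hpos2 hpos1.le ((add_comm _ _).trans hsum)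
      (hZs.trans (add_comm _ _)) l1)
  have heq := hΦinj (hQ ⟨Q1, hF1, rfl⟩ ⟨Q2, hF2, rfl⟩
    ⟨_, _, hpos1, hpos2, hsum, funext fun C => (hsplit C).symm⟩)
  -- Extremality forces `Q1 = Q`, but conditioning on `A` kills `Aᶜ`.
  have : (Q1 : Measure B.Path) Aᶜ = 0 := by
    change ProbabilityTheory.cond (Q : Measure B.Path) A Aᶜ = 0
    rw [ProbabilityTheory.cond_apply hA]
    simp
  rw [heq] at this
  exact h2 this

/-! ### Finite paths and their cylinders -/

namespace FinPath

theorem ext_edge {n : ℕ} {w : B.V n} {p q : B.FinPath n w}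
    (h : ∀ i (hi : i < n), p.edge i hi = q.edge i hi) : p = q := by
  have hv : p.vert = q.vert := by
    funext i hi
    rcases hi.lt_or_eq with hlt | rfl
    · rw [← p.s_edge i hlt, ← q.s_edge i hlt, h]
    · rw [p.vert_last, q.vert_last]
  have he : p.edge = q.edge := by
    funext i hi
    exact h i hi
  cases p
  cases q
  simp only at hv he
  subst hv he
  rfl

/-- The initial segment of length `n` of an infinite path that goes through `w`. -/
def ofPath {n : ℕ} {w : B.V n} (x : B.Path) (hx : x.vertex n = w) : B.FinPath n w where
  vert i _ := x.vertex i
  edge i _ := x.edge i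
  s_edge _ _ := rfl
  r_edge i _ := x.compat i
  vert_last := hx

/-- Surjectivity of the source maps lets a finite path be continued edge by edge. -/
theorem exists_mem_cylinder {n : ℕ} {w : B.V n} (p : B.FinPath n w) :
    ∃ x : B.Path, x.vertex n = w ∧ x ∈ p.cylinder := by
  choose t ht using B.s_surjective
  let g : ∀ k, B.E k := fun k => Nat.rec (motive := fun k => B.E k)
    (if h : 0 < n then p.edge 0 h else t 0 B.root)
    (fun k e => if h : k + 1 < n then p.edge (k + 1) h else t (k + 1) (B.r k e)) k
  have hg : ∀ k (h : k < n), g k = p.edge k h := by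
    intro k h
    cases k with
    | zero => exact dif_pos h
    | succ k => exact dif_pos h
  let x : B.Path := ⟨g, fun i => by
    by_cases h : i + 1 < n
    · rw [hg i (by omega), hg (i + 1) h, p.r_edge, p.s_edge]
    · have : g (i + 1) = t (i + 1) (B.r i (g i)) := dif_neg h
      rw [this, ht]⟩
  refine ⟨x, ?_, hg⟩
  cases n with
  | zero => exact (B.eq_root _).trans (B.eq_root _).symm
  | succ n =>
    rw [vertex_succ, ← p.vert_last, ← p.r_edge n n.lt_succ_self]
    exact congrArg _ (hg n _)

theorem vertex_eq_of_mem_cylinder {n : ℕ} {w : B.V n} {p : B.FinPath n w} {x : B.Path}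
    (hx : x ∈ p.cylinder) : x.vertex n = w := by
  obtain ⟨y, hy, hyp⟩ := p.exists_mem_cylinder
  rw [← hy]
  exact vertex_eq_of_agree fun i hi => (hx i hi).trans (hyp i hi).symm

theorem cylinder_eq_prefixCylinder {n : ℕ} {w : B.V n} {p : B.FinPath n w} {y : B.Path}
    (hy : y ∈ p.cylinder) : p.cylinder = prefixCylinder n y := by
  ext x
  exact forall₂_congr fun i hi => by rw [hy i hi]

theorem isClopen_cylinder {n : ℕ} {w : B.V n} (p : B.FinPath n w) : IsClopen p.cylinder := by
  obtain ⟨y, -, hy⟩ := p.exists_mem_cylinder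
  rw [cylinder_eq_prefixCylinder hy]
  exact isClopen_prefixCylinder n y

/-- The action of an exchange of initial segments on longer finite paths. -/
noncomputable def swap {m n : ℕ} {y z : B.Path} (h : y.vertex m = z.vertex m) (hmn : m ≤ n)
    {w : B.V n} (p : B.FinPath n w) : B.FinPath n w :=
  ofPath (Path.swap m y z h p.exists_mem_cylinder.choose)
    ((congrArg (B.s n) (swap_edge_of_le h _ hmn)).trans p.exists_mem_cylinder.choose_spec.1)

theorem swap_edge {m n : ℕ} {y z : B.Path} (h : y.vertex m = z.vertex m) (hmn : m ≤ n)
    {w : B.V n} (p : B.FinPath n w) {x : B.Path} (hx : x ∈ p.cylinder) (i : ℕ) (hi : i < n) :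
    (p.swap h hmn).edge i hi = (Path.swap m y z h x).edge i :=
  swap_agree h hmn (fun j hj => (p.exists_mem_cylinder.choose_spec.2 j hj).trans (hx j hj).symm) hi

theorem swap_involutive {m n : ℕ} {y z : B.Path} (h : y.vertex m = z.vertex m) (hmn : m ≤ n)
    {w : B.V n} : Function.Involutive fun p : B.FinPath n w => p.swap h hmn := by
  intro p
  obtain ⟨x, -, hx⟩ := p.exists_mem_cylinder
  refine ext_edge fun i hi => ?_
  have hx' : Path.swap m y z h x ∈ (p.swap h hmn).cylinder := fun j hj =>
    (swap_edge h hmn p hx j hj).symm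
  rw [swap_edge h hmn _ hx', Path.swap_involutive h x, hx i hi]

end FinPath

theorem IsInvariant.measure_cylinder_eq {μ : Measure B.Path} (hμ : IsInvariant μ) {n : ℕ}
    {w : B.V n} (p q : B.FinPath n w) : μ p.cylinder = μ q.cylinder := by
  obtain ⟨y, hyw, hy⟩ := p.exists_mem_cylinder
  obtain ⟨z, hzw, hz⟩ := q.exists_mem_cylinder
  have h : y.vertex n = z.vertex n := hyw.trans hzw.symm
  rw [← hμ p.cylinder (Path.swap n y z h) p.isClopen_cylinder.isOpen.measurableSet
    (continuous_swap h).measurable (swap_involutive h).injective.injOn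
    fun x _ => tailEquiv_swap h x, Set.image_eq_preimage_of_inverse
      (swap_involutive h).leftInverse (swap_involutive h).rightInverse]
  congr 1
  rw [FinPath.cylinder_eq_prefixCylinder hy, FinPath.cylinder_eq_prefixCylinder hz]
  ext x
  constructor
  · intro hx i hi
    rw [← swap_involutive h x, swap_edge_of_mem_left h hx hi]
  · intro hx i hi
    rw [swap_edge_of_mem_right h hx hi]

/-! ### The level measures and their weak limit -/

namespace Subdiagram

variable (S : B.Subdiagram)

/-- The paths of the whole diagram whose first `n` edges belong to the subdiagram. -/
def initialSet (n : ℕ) : Set B.Path := {x | ∀ i, i < n → x.edge i ∈ S.E i}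

theorem isClopen_initialSet (n : ℕ) : IsClopen (S.initialSet n) := by
  have : S.initialSet n = ⋂ i ∈ Set.Iio n, {x : B.Path | x.edge i ∈ S.E i} := by
    ext; simp [initialSet]
  rw [this]
  exact (Set.finite_Iio n).isClopen_biInter fun i _ => isClopen_edge_mem i _

theorem antitone_initialSet : Antitone S.initialSet :=
  fun _ _ hmn _ hx i hi => hx i (hi.trans_le hmn)

theorem pathSet_eq_iInter : S.pathSet = ⋂ n, S.initialSet n := by
  ext x
  simp only [pathSet, Set.mem_range, Set.mem_iInter]
  constructor
  · rintro ⟨y, rfl⟩ n i -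
    exact (y.edge i).2
  · intro hx
    exact ⟨⟨fun i => ⟨x.edge i, hx (i + 1) i i.lt_succ_self⟩, fun i => Subtype.ext (x.compat i)⟩,
      rfl⟩

section replacePrefix

variable {S} {n : ℕ} {w : S.toDiagram.V n} {f : B.FinPath n w.1} {x : S.toDiagram.Path}

theorem replacePrefix_edge_of_lt (hx : x.vertex n = w) {i : ℕ} (hi : i < n) :
    (S.replacePrefix w f x).edge i = f.edge i hi := by
  simp [replacePrefix, hx, hi]

theorem replacePrefix_edge_of_le {i : ℕ} (hi : n ≤ i) :
    (S.replacePrefix w f x).edge i = (x.edge i).1 := by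
  unfold replacePrefix
  split_ifs
  · simp [not_lt.2 hi]
  · rfl

theorem replacePrefix_mem_saturation : S.replacePrefix w f x ∈ S.saturation :=
  ⟨S.incl x, ⟨x, rfl⟩, n, fun _ hi => replacePrefix_edge_of_le hi⟩

theorem replacePrefix_mem_cylinder (hx : x.vertex n = w) : S.replacePrefix w f x ∈ f.cylinder :=
  fun _ hi => replacePrefix_edge_of_lt hx hi

theorem swap_replacePrefix {m : ℕ} {y z : B.Path} (h : y.vertex m = z.vertex m) (hmn : m ≤ n)
    (hx : x.vertex n = w) :
    Path.swap m y z h (S.replacePrefix w f x) = S.replacePrefix w (f.swap h hmn) x := by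
  ext i
  by_cases hi : i < n
  · rw [replacePrefix_edge_of_lt hx hi,
      FinPath.swap_edge h hmn f (replacePrefix_mem_cylinder hx) i hi]
  · have hi' := not_lt.1 hi
    rw [replacePrefix_edge_of_le hi', swap_edge_of_le h _ (hmn.trans hi'),
      replacePrefix_edge_of_le hi']

end replacePrefix

/-- A finite path of the subdiagram, viewed as a path of the whole diagram. -/
def inclFinPath {n : ℕ} {w : S.toDiagram.V n} (p : S.toDiagram.FinPath n w) :
    B.FinPath n w.1 where
  vert i hi := (p.vert i hi).1
  edge i hi := (p.edge i hi).1
  s_edge i hi := congrArg Subtype.val (p.s_edge i hi)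
  r_edge i hi := congrArg Subtype.val (p.r_edge i hi)
  vert_last := congrArg Subtype.val p.vert_last

theorem inclFinPath_injective {n : ℕ} {w : S.toDiagram.V n} :
    Function.Injective (S.inclFinPath (w := w)) := fun _ _ h => FinPath.ext_edge fun i hi =>
  Subtype.ext (congrArg (fun r : B.FinPath n w.1 => r.edge i hi) h)

theorem replacePrefix_inclFinPath_mem_pathSet {n : ℕ} {w : S.toDiagram.V n}
    {p : S.toDiagram.FinPath n w} {x : S.toDiagram.Path} (hx : x.vertex n = w) :
    S.replacePrefix w (S.inclFinPath p) x ∈ S.pathSet := by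
  rw [pathSet_eq_iInter]
  refine Set.mem_iInter.2 fun m i _ => ?_
  by_cases hi : i < n
  · rw [replacePrefix_edge_of_lt hx hi]
    exact (p.edge i hi).2
  · rw [replacePrefix_edge_of_le (not_lt.1 hi)]
    exact (x.edge i).2

variable (μ : Measure S.toDiagram.Path)

/-- For each vertex `w`, the exchange permutes the finite paths to `w` and leaves the tails alone,
so it only permutes copies of the same measure. -/
theorem map_swap_levelExtension {m n : ℕ} (hmn : m ≤ n) {y z : B.Path}
    (h : y.vertex m = z.vertex m) :
    (S.levelExtension μ n).map (Path.swap m y z h) = S.levelExtension μ n := by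
  have hT := (continuous_swap h).measurable
  ext A hA
  rw [Measure.map_apply hT hA, levelExtension, Measure.sum_apply _ (hT hA), Measure.sum_apply _ hA]
  refine tsum_congr fun w => ?_
  rw [Measure.sum_apply _ (hT hA), Measure.sum_apply _ hA,
    ← ((FinPath.swap_involutive h hmn).toPerm _).tsum_eq fun f : B.FinPath n w.1 =>
      ((μ.restrict (Classical.choice (S.toDiagram.nonempty_path_through n w)).cylinder).map
        (S.replacePrefix w f)) A]
  refine tsum_congr fun f => ?_
  have hm := S.measurable_replacePrefix w
  rw [Measure.map_apply (hm f) (hT hA), Measure.map_apply (hm _) hA,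
    Measure.restrict_apply ((hm f) (hT hA)), Measure.restrict_apply ((hm _) hA)]
  congr 1
  ext x
  simp only [Set.mem_inter_iff, Set.mem_preimage]
  refine and_congr_left fun hx => ?_
  rw [swap_replacePrefix h hmn (FinPath.vertex_eq_of_mem_cylinder hx)]
  rfl

theorem levelExtension_univ (n : ℕ) :
    S.levelExtension μ n Set.univ = ∑' w : S.toDiagram.V n, ∑' _ : B.FinPath n w.1,
      μ (Classical.choice (S.toDiagram.nonempty_path_through n w)).cylinder := by
  rw [levelExtension, Measure.sum_apply _ MeasurableSet.univ]
  refine tsum_congr fun w => ?_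
  rw [Measure.sum_apply _ MeasurableSet.univ]
  refine tsum_congr fun f => ?_
  rw [Measure.map_apply (S.measurable_replacePrefix w f) MeasurableSet.univ, Set.preimage_univ,
    Measure.restrict_apply_univ]

theorem levelExtension_univ_le (n : ℕ) :
    S.levelExtension μ n Set.univ ≤ S.extension μ S.saturation := by
  refine le_trans ?_ ((le_iSup (S.levelExtension μ) n) S.saturation)
  rw [levelExtension_univ]
  refine le_trans (ENNReal.tsum_le_tsum fun w => ?_) (Measure.le_sum_apply _ _)
  refine le_trans (ENNReal.tsum_le_tsum fun f => ?_) (Measure.le_sum_apply _ _)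
  refine le_trans ?_ (Measure.le_map_apply (S.measurable_replacePrefix w f).aemeasurable _)
  -- This also covers the default value of `replacePrefix`, which lies in the path space of the
  -- subdiagram. The saturation need not be known to be measurable: only lower bounds valid for all
  -- sets are used.
  have : S.replacePrefix w f ⁻¹' S.saturation = Set.univ :=
    Set.eq_univ_of_forall fun _ => replacePrefix_mem_saturation
  rw [this, Measure.restrict_apply_univ]

/-- Among the copies are those along finite paths of the subdiagram itself; by invariance of `μ`
they have the masses of the corresponding cylinders, which cover everything. -/
theorem measure_univ_le_levelExtension_pathSet (hμ : IsInvariant μ) (n : ℕ) :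
    μ Set.univ ≤ S.levelExtension μ n S.pathSet := by
  have : Finite (S.toDiagram.V n) := S.toDiagram.finite_V n
  have hfin : ∀ w, Finite (S.toDiagram.FinPath n w) := fun w =>
    Finite.of_injective (fun p (i : Fin n) => p.edge i i.2) fun p q h =>
      FinPath.ext_edge fun i hi => congrFun h ⟨i, hi⟩
  have hcov : (Set.univ : Set S.toDiagram.Path) ⊆
      ⋃ w, ⋃ p : S.toDiagram.FinPath n w, p.cylinder := fun x _ =>
    Set.mem_iUnion₂.2 ⟨x.vertex n, FinPath.ofPath x rfl, fun _ _ => rfl⟩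
  calc μ Set.univ ≤ ∑' w, ∑' p : S.toDiagram.FinPath n w, μ p.cylinder :=
        (measure_mono hcov).trans ((measure_iUnion_le _).trans
          (ENNReal.tsum_le_tsum fun w => measure_iUnion_le _))
    _ ≤ S.levelExtension μ n S.pathSet := by
        refine le_trans (ENNReal.tsum_le_tsum fun w => ?_) (Measure.le_sum_apply _ _)
        refine le_trans ?_ (Measure.le_sum_apply _ _)
        refine le_trans (ENNReal.tsum_le_tsum fun p => ?_)
          (ENNReal.tsum_comp_le_tsum_of_injective S.inclFinPath_injective _)
        set e := Classical.choice (S.toDiagram.nonempty_path_through n w)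
        refine le_trans ?_ (Measure.le_map_apply (S.measurable_replacePrefix w _).aemeasurable _)
        rw [hμ.measure_cylinder_eq p e, Measure.restrict_apply'
          e.isClopen_cylinder.isOpen.measurableSet]
        exact measure_mono fun x hx => ⟨replacePrefix_inclFinPath_mem_pathSet S
          (FinPath.vertex_eq_of_mem_cylinder hx), hx⟩

theorem exists_isSwapInvariant_of_extension_ne_top (hprob : IsProbabilityMeasure μ)
    (hinv : IsInvariant μ) (hfin : S.extension μ S.saturation ≠ ∞) :
    ∃ P : ProbabilityMeasure B.Path, IsSwapInvariant (P : Measure B.Path) ∧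
      (P : Measure B.Path) S.pathSet ≠ 0 := by
  set M := S.extension μ S.saturation
  have hone : ∀ n, 1 ≤ S.levelExtension μ n S.pathSet := fun n => by
    simpa using S.measure_univ_le_levelExtension_pathSet μ hinv n
  have hne : ∀ n, S.levelExtension μ n Set.univ ≠ 0 := fun n =>
    (zero_lt_one.trans_le ((hone n).trans (measure_mono (Set.subset_univ _)))).ne'
  have htop : ∀ n, S.levelExtension μ n Set.univ ≠ ∞ := fun n =>
    ne_top_of_le_ne_top hfin (S.levelExtension_univ_le μ n)
  let P : ℕ → ProbabilityMeasure B.Path := fun n =>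
    ⟨(S.levelExtension μ n Set.univ)⁻¹ • S.levelExtension μ n,
      ⟨by rw [Measure.smul_apply, smul_eq_mul, ENNReal.inv_mul_cancel (hne n) (htop n)]⟩⟩
  have hPM : ∀ n, M⁻¹ ≤ (P n : Measure B.Path) S.pathSet := fun n =>
    calc M⁻¹ ≤ (S.levelExtension μ n Set.univ)⁻¹ * 1 := by
          rw [mul_one]
          exact ENNReal.inv_le_inv.2 (S.levelExtension_univ_le μ n)
      _ ≤ _ := mul_le_mul_right (hone n) _
  -- A limit along an ultrafilter finer than `atTop` exists by compactness, and each fixed exchange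
  -- of length `m` eventually preserves `P n`.
  let 𝒰 : Ultrafilter ℕ := Ultrafilter.of atTop
  obtain ⟨Q, -, hQ⟩ := isCompact_univ.ultrafilter_le_nhds (𝒰.map P) (by simp)
  have hQ' : Tendsto P 𝒰 (𝓝 Q) := hQ
  refine ⟨Q, fun m y z h => ?_, ?_⟩
  · have h1 := ((ProbabilityMeasure.continuous_map (continuous_swap h)).tendsto Q).comp hQ'
    have h2 : ∀ᶠ n in (𝒰 : Filter ℕ), P n =
        (P n).map (continuous_swap h).measurable.aemeasurable := by
      have : ∀ᶠ n in (𝒰 : Filter ℕ), m ≤ n :=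
        Ultrafilter.of_le atTop (eventually_ge_atTop m)
      filter_upwards [this] with n hn
      refine ProbabilityMeasure.toMeasure_injective ?_
      rw [ProbabilityMeasure.toMeasure_map]
      change _ • _ = Measure.map _ (_ • _)
      rw [Measure.map_smul, S.map_swap_levelExtension μ hn h]
    have h3 := tendsto_nhds_unique (hQ'.congr' h2) h1
    rw [← ProbabilityMeasure.toMeasure_map Q (continuous_swap h).measurable.aemeasurable, ← h3]
  · have h1 : M⁻¹ ≤ (Q : Measure B.Path) S.pathSet := by
      rw [S.pathSet_eq_iInter, S.antitone_initialSet.measure_iInter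
        (fun n => (S.isClopen_initialSet n).isOpen.measurableSet.nullMeasurableSet)
        ⟨0, measure_ne_top _ _⟩]
      refine le_iInf fun k => ge_of_tendsto
        (((continuous_measure_of_isClopen (S.isClopen_initialSet k)).tendsto Q).comp hQ')
        (Eventually.of_forall fun n => (hPM n).trans (measure_mono ?_))
      rw [S.pathSet_eq_iInter]
      exact Set.iInter_subset _ k
    exact ((ENNReal.inv_pos.2 hfin).trans_le h1).ne'

end Subdiagram

end BratteliDiagram

theorem mainTheorem8 (B : BratteliDiagram.{u, v}) (S : B.Subdiagram)
    (hthin : BratteliDiagram.IsThin S.pathSet)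
    (μ : Measure S.toDiagram.Path) (hprob : IsProbabilityMeasure μ)
    (hinv : BratteliDiagram.IsInvariant μ) :
    S.extension μ S.saturation = ∞ := by
  by_contra hfin
  obtain ⟨P, hP, hP0⟩ := S.exists_isSwapInvariant_of_extension_ne_top μ hprob hinv hfin
  obtain ⟨Q, hQ, hQe, hle⟩ := BratteliDiagram.exists_isErgodic_measure_ge P hP S.isClopen_initialSet
    S.antitone_initialSet
  rw [← S.pathSet_eq_iInter, hthin Q inferInstance hQ.isInvariant hQe] at hle
  exact hP0 (le_antisymm hle zero_le)
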